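/- Let $\Lambda(X)$ be the ring of symmetric functions over $\mathbb{Q}$ in the variables $X=\{x_1,x_2,\ldots\}$, with power sums $p_k$, and let $\Lambda(X_1|\cdots|X_r)=\Lambda(X_1)\otimes_{\mathbb{Q}}\cdots\otimes_{\mathbb{Q}}\Lambda(X_r)$, where $X_j=\{x_{j,1},x_{j,2},\ldots\}$. For $n_1,\ldots,n_r\ge 1$ write $f(X_1^{(n_1)}|\cdots|X_r^{(n_r)})$ for the polynomial obtained from $f\in\Lambda(X_1|\cdots|X_r)$ by setting $x_{j,k}=0$ for all $j$ and all $k>n_j$, and write $f(X_1^{(n_1)}|\cdots|X_i^{(n_i)}+z|\cdots|X_r^{(n_r)})$ for the polynomial obtained by evaluating the $i$-th alphabet instead at the $n_i+1$ variables $x_{i,1},\ldots,x_{i,n_i},z$, where $z$ is a new variable. For two variables $x,y$ let $\xi_{x,y}(F)=\frac{xF(x,y)-yF(y,x)}{x-y}$, let $\xi^{(j)}_k=\xi_{x_{j,k},x_{j,k+1}}$, and let $\langle z^0\rangle$ denote the coefficient of $z^0$. For $1\le i\le r-1$ put $$D_i^{(n_1|\cdots|n_r)}(f)=\langle z^0\rangle\,\xi^{(i+1)}_{n_{i+1}-1}\cdots\xi^{(i+1)}_1\,\xi_{z,x_{i+1,1}}\Big(f(X_1^{(n_1)}|\cdots|X_i^{(n_i)}+z|\cdots|X_r^{(n_r)})\Big).$$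 Then for every $f\in\Lambda(X_1|\cdots|X_r)$ there is a unique $D_i(f)\in\Lambda(X_1|\cdots|X_r)$, the stable limit of the polynomials $D_i^{(n_1|\cdots|n_r)}(f)$, whose restriction to the variables $x_{j,k}$ with $k\le n_j$ is $D_i^{(n_1|\cdots|n_r)}(f)$ for all $n_1,\ldots,n_r\ge1$, and $$D_i(f)=\langle z^0\rangle\, f(X_1|\cdots|X_i+z^{-1}|X_{i+1}-z^{-1}|\cdots|X_r)\,\Omega(zX_{i+1}).$$ Here the right-hand side is computed in formal Laurent series in $z$ over $\Lambda(X_1|\cdots|X_r)$; $f(X_1|\cdots|X_i+z^{-1}|X_{i+1}-z^{-1}|\cdots|X_r)$ is the image of $f$ under the $\mathbb{Q}$-algebra homomorphism with $p_k(X_i)\mapsto p_k(X_i)+z^{-k}$, $p_k(X_{i+1})\mapsto p_k(X_{i+1})-z^{-k}$ and $p_k(X_j)\mapsto p_k(X_j)$ for $j\ne i,i+1$ $(k\ge 1)$; and $\Omega(zX_{i+1})=\sum_\lambda z^{|\lambda|}m_\lambda(X_{i+1})$, the sum being over all partitions $\lambda$ and $m_\lambda$ being the monomial symmetric functions. -/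

import Mathlib

noncomputable section

open scoped TensorProduct

namespace PlethysticOperators

/-! ### Symmetric functions in one alphabet -/

/-- The ring `Λ(X)` of symmetric functions over `ℚ` in the variables `x₀, x₁, …`: formal power
series of bounded degree that are fixed by every permutation of the variables. -/
def SymmFun : Subalgebra ℚ (MvPowerSeries ℕ ℚ) where
  carrier := {f | (∀ σ : Equiv.Perm ℕ, MvPowerSeries.renameEquiv ℚ σ f = f) ∧
    ∃ d : ℕ, ∀ e : ℕ →₀ ℕ, MvPowerSeries.coeff e f ≠ 0 → e.degree ≤ d}
  mul_mem' := by
    rintro f g ⟨hf, df, hdf⟩ ⟨hg, dg, hdg⟩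
    refine ⟨fun σ => by rw [map_mul, hf, hg], df + dg, fun e he => ?_⟩
    classical
    rw [MvPowerSeries.coeff_mul] at he
    obtain ⟨⟨a, b⟩, hab, h⟩ := Finset.exists_ne_zero_of_sum_ne_zero he
    rw [Finset.HasAntidiagonal.mem_antidiagonal] at hab
    have h1 := hdf a (left_ne_zero_of_mul h)
    have h2 := hdg b (right_ne_zero_of_mul h)
    dsimp only at hab
    rw [← hab, map_add]
    omega
  add_mem' := by
    rintro f g ⟨hf, df, hdf⟩ ⟨hg, dg, hdg⟩
    refine ⟨fun σ => by rw [map_add, hf, hg], df + dg, fun e he => ?_⟩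
    by_cases h : MvPowerSeries.coeff e f = 0
    · have h2 := hdg e (by simpa [h] using he)
      omega
    · have h1 := hdf e h
      omega
  algebraMap_mem' c := by
    refine ⟨fun σ => AlgEquiv.commutes _ c, 0, fun e he => ?_⟩
    classical
    rw [MvPowerSeries.algebraMap_apply, MvPowerSeries.coeff_C] at he
    have : e = 0 := by
      by_contra h
      simp [h] at he
    simp [this]

theorem renameEquiv_eq_self_iff (σ : Equiv.Perm ℕ) (f : MvPowerSeries ℕ ℚ) :
    MvPowerSeries.renameEquiv ℚ σ f = f ↔
      ∀ e : ℕ →₀ ℕ, MvPowerSeries.coeff (e.embDomain σ.toEmbedding) f =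
        MvPowerSeries.coeff e f := by
  have key : ∀ e : ℕ →₀ ℕ, MvPowerSeries.coeff (e.embDomain σ.toEmbedding)
      (MvPowerSeries.renameEquiv ℚ σ f) = MvPowerSeries.coeff e f := fun e =>
    MvPowerSeries.coeff_embDomain_rename σ.toEmbedding f e
  constructor
  · intro h e
    have := key e
    rwa [h] at this
  · intro h
    ext e
    obtain ⟨e', rfl⟩ : ∃ e', e = Finsupp.embDomain σ.toEmbedding e' := by
      refine ⟨e.embDomain σ.symm.toEmbedding, ?_⟩
      ext a
      obtain ⟨b, rfl⟩ := σ.surjective a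
      have h1 := Finsupp.embDomain_apply_self σ.toEmbedding
        (e.embDomain σ.symm.toEmbedding) b
      have h2 := Finsupp.embDomain_apply_self σ.symm.toEmbedding e (σ b)
      simp only [Equiv.coe_toEmbedding, Equiv.symm_apply_apply] at h1 h2
      rw [h1, h2]
    rw [key, h]

theorem degree_embDomain {α β : Type*} (i : α ↪ β) (e : α →₀ ℕ) :
    (e.embDomain i).degree = e.degree := by
  simp [Finsupp.degree_apply, Finsupp.support_embDomain]

theorem mem_symmFun_of_coeff {f : MvPowerSeries ℕ ℚ} (d : ℕ)
    (h : ∀ (σ : Equiv.Perm ℕ) (e : ℕ →₀ ℕ), MvPowerSeries.coeff (e.embDomain σ.toEmbedding) f =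
        MvPowerSeries.coeff e f)
    (hd : ∀ e : ℕ →₀ ℕ, MvPowerSeries.coeff e f ≠ 0 → e.degree ≤ d) : f ∈ SymmFun :=
  ⟨fun σ => (renameEquiv_eq_self_iff σ f).2 (h σ), d, hd⟩

/-- The power sum `∑ᵢ xᵢ ^ k` as a formal power series, for `k ≥ 1`. -/
def psumSeries (k : ℕ) : MvPowerSeries ℕ ℚ :=
  fun e => open Classical in if ∃ i, e = Finsupp.single i k then 1 else 0

theorem coeff_psumSeries (k : ℕ) (e : ℕ →₀ ℕ) : MvPowerSeries.coeff e (psumSeries k) =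
    open Classical in if ∃ i, e = Finsupp.single i k then 1 else 0 := rfl

theorem psumSeries_mem (k : ℕ) : psumSeries k ∈ SymmFun := by
  refine mem_symmFun_of_coeff k (fun σ e => ?_) (fun e he => ?_)
  · have : (∃ i, e.embDomain σ.toEmbedding = Finsupp.single i k) ↔
        ∃ i, e = Finsupp.single i k := by
      constructor
      · rintro ⟨i, hi⟩
        refine ⟨σ.symm i, Finsupp.embDomain_injective σ.toEmbedding ?_⟩
        rw [hi, Finsupp.embDomain_single]
        simp
      · rintro ⟨i, rfl⟩
        exact ⟨σ i, by rw [Finsupp.embDomain_single]; rfl⟩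
    rw [coeff_psumSeries, coeff_psumSeries]
    by_cases h : ∃ i, e = Finsupp.single i k
    · rw [if_pos h, if_pos (this.2 h)]
    · rw [if_neg h, if_neg (mt this.1 h)]
  · rw [coeff_psumSeries] at he
    by_cases h : ∃ i, e = Finsupp.single i k
    · obtain ⟨i, rfl⟩ := h
      simp
    · simp [h] at he

/-- The power sum `p_k = ∑ᵢ xᵢ ^ k` in `Λ(X)`, for `k ≥ 1`. -/
def psum (k : ℕ) : SymmFun := ⟨psumSeries k, psumSeries_mem k⟩

/-- The plethystic exponential `Ω(X) = ∑_λ m_λ(X)`: every monomial has coefficient one. -/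
def Omega : MvPowerSeries ℕ ℚ := fun _ => 1

theorem homogeneousComponent_mem {f : MvPowerSeries ℕ ℚ} (k : ℕ)
    (h : ∀ σ : Equiv.Perm ℕ, MvPowerSeries.renameEquiv ℚ σ f = f) :
    MvPowerSeries.homogeneousComponent k f ∈ SymmFun := by
  refine mem_symmFun_of_coeff k (fun σ e => ?_) (fun e he => ?_)
  · rw [MvPowerSeries.coeff_homogeneousComponent, MvPowerSeries.coeff_homogeneousComponent,
      degree_embDomain, (renameEquiv_eq_self_iff σ f).1 (h σ)]
  · rw [MvPowerSeries.coeff_homogeneousComponent] at he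
    by_contra h
    exact he (if_neg (by omega))

/-- The homogeneous component of degree `k` of `Ω(X)`, as a symmetric function. -/
def OmegaPart (k : ℕ) : SymmFun :=
  ⟨MvPowerSeries.homogeneousComponent k Omega,
    homogeneousComponent_mem k fun σ => (renameEquiv_eq_self_iff σ Omega).2 fun _ => rfl⟩

/-- Setting all but the first `n` variables to zero gives a polynomial. -/
theorem killCompl_mem_range (n : ℕ) (f : SymmFun) :
    MvPowerSeries.killCompl Fin.valEmbedding (f : MvPowerSeries ℕ ℚ) ∈
      (MvPolynomial.coeToMvPowerSeries.algHom (R := ℚ) (σ := Fin n) ℚ).range := by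
  obtain ⟨d, hd⟩ := f.2.2
  refine ⟨MvPowerSeries.truncTotal (d + 1)
    (MvPowerSeries.killCompl Fin.valEmbedding (f : MvPowerSeries ℕ ℚ)), ?_⟩
  ext e
  have h1 : ∀ q : MvPolynomial (Fin n) ℚ,
      (MvPolynomial.coeToMvPowerSeries.algHom (R := ℚ) (σ := Fin n) ℚ) q = (q : MvPowerSeries _ ℚ) :=
    fun q => by ext; simp
  change MvPowerSeries.coeff e ((MvPolynomial.coeToMvPowerSeries.algHom (R := ℚ) (σ := Fin n) ℚ) _)
    = _
  rw [h1, MvPolynomial.coeff_coe, MvPowerSeries.coeff_truncTotal_eq_ite]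
  split_ifs with h
  · rfl
  · rw [MvPowerSeries.coeff_killCompl]
    by_contra h2
    have := hd _ (Ne.symm h2)
    rw [degree_embDomain] at this
    omega

theorem coe_algHom_injective (n : ℕ) : Function.Injective
    (MvPolynomial.coeToMvPowerSeries.algHom (R := ℚ) (σ := Fin n) ℚ) := by
  intro a b h
  ext e
  have := congrArg (MvPowerSeries.coeff e) h
  simpa using this

/-- The restriction `f ↦ f(x₀, …, x_{n-1}, 0, 0, …)` of a symmetric function to `n` variables. -/
def restrict (n : ℕ) : SymmFun →ₐ[ℚ] MvPolynomial (Fin n) ℚ :=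
  (AlgEquiv.ofInjective _ (coe_algHom_injective n)).symm.toAlgHom.comp
    (((MvPowerSeries.killCompl Fin.valEmbedding).comp SymmFun.val).codRestrict _
      (killCompl_mem_range n))

theorem coeff_restrict (n : ℕ) (f : SymmFun) (e : Fin n →₀ ℕ) :
    (restrict n f).coeff e =
      MvPowerSeries.coeff (e.embDomain Fin.valEmbedding) (f : MvPowerSeries ℕ ℚ) := by
  rw [← MvPowerSeries.coeff_killCompl, ← MvPolynomial.coeff_coe]
  congr 1
  have h := (AlgEquiv.ofInjective _ (coe_algHom_injective n)).apply_symm_apply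
    ⟨_, killCompl_mem_range n f⟩
  have h2 := congrArg Subtype.val h
  rw [AlgEquiv.ofInjective_apply] at h2
  rw [← show _ = (MvPowerSeries.killCompl Fin.valEmbedding) (f : MvPowerSeries ℕ ℚ) from h2]
  ext
  simp
  rfl

/-- The value `f(a₁ + ⋯ + aₙ)` of a symmetric function at a finite alphabet. -/
def evalAt {A : Type*} [CommRing A] [Algebra ℚ A] {n : ℕ} (a : Fin n → A) : SymmFun →ₐ[ℚ] A :=
  (MvPolynomial.aeval a).comp (restrict n)

/-! ### Power sums are free generators, and plethystic substitution -/

theorem restrict_psum (n : ℕ) {k : ℕ} (hk : k ≠ 0) :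
    restrict n (psum k) = MvPolynomial.psum (Fin n) ℚ k := by
  classical
  ext e
  rw [coeff_restrict, psum, coeff_psumSeries, MvPolynomial.psum, MvPolynomial.coeff_sum]
  simp only [MvPolynomial.coeff_X_pow]
  by_cases h : ∃ i, e = Finsupp.single i k
  · obtain ⟨i, rfl⟩ := h
    rw [if_pos ⟨(i : ℕ), by rw [Finsupp.embDomain_single]; rfl⟩,
      Finset.sum_eq_single i (fun j _ hj => if_neg fun hh => hj
        (Finsupp.single_left_injective hk hh)) (by simp)]
    simp
  · rw [if_neg, Finset.sum_eq_zero]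
    · intro i _
      exact if_neg fun hh => h ⟨i, hh.symm⟩
    · rintro ⟨i, hi⟩
      apply h
      have hmem : i ∈ (e.embDomain Fin.valEmbedding).support := by
        rw [hi]; simp [hk]
      rw [Finsupp.support_embDomain, Finset.mem_map] at hmem
      obtain ⟨j, _, rfl⟩ := hmem
      refine ⟨j, Finsupp.embDomain_injective Fin.valEmbedding ?_⟩
      rw [hi, Finsupp.embDomain_single]

theorem esymm_mem_range (n k : ℕ) (hkn : k ≤ n) : MvPolynomial.esymm (Fin n) ℚ k ∈
    (MvPolynomial.aeval (R := ℚ) fun m : Fin n => MvPolynomial.psum (Fin n) ℚ (m + 1)).range := by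
  induction k using Nat.strong_induction_on with
  | _ k ih =>
    rcases Nat.eq_zero_or_pos k with rfl | hk
    · rw [MvPolynomial.esymm_zero]
      exact one_mem _
    · have h := MvPolynomial.mul_esymm_eq_sum (Fin n) ℚ k
      have h2 : MvPolynomial.esymm (Fin n) ℚ k =
          ((k : ℚ)⁻¹) • ((k : MvPolynomial (Fin n) ℚ) * MvPolynomial.esymm (Fin n) ℚ k) := by
        have : (k : MvPolynomial (Fin n) ℚ) = MvPolynomial.C (k : ℚ) := by simp
        rw [this, ← MvPolynomial.smul_eq_C_mul, smul_smul, inv_mul_cancel₀, one_smul]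
        exact_mod_cast hk.ne'
      rw [h2, h]
      refine Subalgebra.smul_mem _ (mul_mem (pow_mem (neg_mem (one_mem _)) _)
        (sum_mem fun a ha => ?_)) _
      rw [Finset.mem_filter, Finset.HasAntidiagonal.mem_antidiagonal] at ha
      refine mul_mem (mul_mem (pow_mem (neg_mem (one_mem _)) _) (ih _ ha.2 (by omega))) ?_
      obtain ⟨b, hb⟩ : ∃ b, a.2 = b + 1 := ⟨a.2 - 1, by omega⟩
      rw [hb]
      exact ⟨MvPolynomial.X ⟨b, by omega⟩, by simp⟩

theorem isSymmetric_mem_range (n : ℕ) {q : MvPolynomial (Fin n) ℚ} (hq : q.IsSymmetric) : q ∈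
    (MvPolynomial.aeval (R := ℚ) fun m : Fin n => MvPolynomial.psum (Fin n) ℚ (m + 1)).range := by
  obtain ⟨Q, hQ⟩ := MvPolynomial.esymmAlgHom_fin_surjective ℚ (le_refl n) ⟨q, hq⟩
  have h := MvPolynomial.esymmAlgHom_apply (σ := Fin n) (R := ℚ) Q
  rw [hQ] at h
  change q = _ at h
  rw [h]
  clear h hQ
  induction Q using MvPolynomial.induction_on with
  | C r => rw [MvPolynomial.aeval_C]; exact Subalgebra.algebraMap_mem _ _
  | add p q hp hq => rw [map_add]; exact add_mem hp hq
  | mul_X p i hp =>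
    rw [map_mul, MvPolynomial.aeval_X]
    exact mul_mem hp (esymm_mem_range n _ i.2)

theorem surjective_endomorphism_injective {A : Type*} [CommRing A] [IsNoetherianRing A]
    (φ : A →+* A) (h : Function.Surjective φ) : Function.Injective φ := by
  have hmono : Monotone fun n : ℕ => RingHom.ker (φ ^ n) := by
    refine monotone_nat_of_le_succ fun n x hx => ?_
    rw [RingHom.mem_ker] at hx ⊢
    rw [pow_succ', RingHom.mul_def, RingHom.comp_apply, hx, map_zero]
  obtain ⟨n, hn⟩ := monotone_stabilizes_iff_noetherian.2 ‹IsNoetherianRing A› ⟨_, hmono⟩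
  have hsurj : Function.Surjective (φ ^ n) := by
    clear hn
    induction n with
    | zero => exact fun x => ⟨x, rfl⟩
    | succ n ih =>
      rw [pow_succ', RingHom.mul_def, RingHom.coe_comp]
      exact h.comp ih
  rw [injective_iff_map_eq_zero]
  intro x hx
  obtain ⟨y, rfl⟩ := hsurj x
  have h1 : y ∈ RingHom.ker (φ ^ (n + 1)) := by
    rw [RingHom.mem_ker, pow_succ', RingHom.mul_def, RingHom.comp_apply, hx]
  have h2 : RingHom.ker (φ ^ n) = RingHom.ker (φ ^ (n + 1)) := hn (n + 1) (Nat.le_succ n)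
  rw [← h2] at h1
  exact h1

theorem aeval_psum_fin_injective (n : ℕ) : Function.Injective
    (MvPolynomial.aeval (R := ℚ) fun m : Fin n => MvPolynomial.psum (Fin n) ℚ (m + 1)) := by
  let F : MvPolynomial (Fin n) ℚ →ₐ[ℚ] MvPolynomial.symmetricSubalgebra (Fin n) ℚ :=
    MvPolynomial.aeval fun m => ⟨MvPolynomial.psum (Fin n) ℚ (m + 1),
      MvPolynomial.psum_isSymmetric (Fin n) ℚ _⟩
  have hF : ∀ Q, (F Q : MvPolynomial (Fin n) ℚ) = MvPolynomial.aeval (R := ℚ)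
      (fun m : Fin n => MvPolynomial.psum (Fin n) ℚ (m + 1)) Q := fun Q =>
    (Subalgebra.mvPolynomial_aeval_coe _ _ _).symm
  let E := MvPolynomial.esymmAlgEquiv (R := ℚ) (Fin n) (n := n) (by simp)
  have hs : Function.Surjective (E.symm.toAlgHom.comp F).toRingHom := by
    intro x
    obtain ⟨Q, hQ⟩ := isSymmetric_mem_range n (E x).2
    refine ⟨Q, ?_⟩
    have : F Q = E x := Subtype.ext (by rw [hF]; exact hQ)
    change E.symm (F Q) = x
    rw [this, E.symm_apply_apply]
  have hi := surjective_endomorphism_injective _ hs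
  intro a b hab
  apply hi
  change E.symm (F a) = E.symm (F b)
  congr 1
  apply Subtype.ext
  rw [hF, hF]
  exact hab

/-- The algebra map `ℚ[t₀, t₁, …] → Λ(X)` sending `t_m` to the power sum `p_{m+1}`. -/
def psumHom : MvPolynomial ℕ ℚ →ₐ[ℚ] SymmFun :=
  MvPolynomial.aeval fun m => psum (m + 1)

theorem restrict_psumHom_rename (n : ℕ) (Q : MvPolynomial (Fin n) ℚ) :
    restrict n (psumHom (MvPolynomial.rename Fin.val Q)) =
      MvPolynomial.aeval (fun m : Fin n => MvPolynomial.psum (Fin n) ℚ (m + 1)) Q := by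
  have : ((restrict n).comp psumHom).comp (MvPolynomial.rename Fin.val) =
      MvPolynomial.aeval (fun m : Fin n => MvPolynomial.psum (Fin n) ℚ (m + 1)) := by
    ext1 i
    simp [psumHom, restrict_psum]
  exact DFunLike.congr_fun this Q

theorem psumHom_injective : Function.Injective psumHom := by
  rw [injective_iff_map_eq_zero]
  intro Q hQ
  obtain ⟨n, hn⟩ : ∃ n, ∀ i ∈ Q.vars, i < n := ⟨Q.vars.sup id + 1, fun i hi =>
    Nat.lt_succ_of_le (Finset.le_sup (f := id) hi)⟩
  obtain ⟨Q', rfl⟩ := MvPolynomial.exists_rename_eq_of_vars_subset_range Q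
    (Fin.val : Fin n → ℕ) Fin.val_injective (fun i hi => ⟨⟨i, hn i hi⟩, rfl⟩)
  have h := restrict_psumHom_rename n Q'
  rw [hQ, map_zero] at h
  rw [aeval_psum_fin_injective n (h.symm.trans (map_zero _).symm), map_zero]

theorem homogeneousComponent_mul (k : ℕ) (f g : MvPowerSeries ℕ ℚ) :
    MvPowerSeries.homogeneousComponent k (f * g) =
      ∑ a ∈ Finset.HasAntidiagonal.antidiagonal k, MvPowerSeries.homogeneousComponent a.1 f *
        MvPowerSeries.homogeneousComponent a.2 g := by
  classical
  ext e
  rw [map_sum]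
  simp only [MvPowerSeries.coeff_homogeneousComponent, MvPowerSeries.coeff_mul]
  rw [Finset.sum_comm]
  have : ∀ b ∈ Finset.HasAntidiagonal.antidiagonal e, ∑ a ∈ Finset.HasAntidiagonal.antidiagonal k,
      ((if b.1.degree = a.1 then MvPowerSeries.coeff b.1 f else 0) *
        (if b.2.degree = a.2 then MvPowerSeries.coeff b.2 g else 0)) =
      if e.degree = k then MvPowerSeries.coeff b.1 f * MvPowerSeries.coeff b.2 g else 0 := by
    intro b hb
    rw [Finset.HasAntidiagonal.mem_antidiagonal] at hb
    have hdeg : e.degree = b.1.degree + b.2.degree := by rw [← hb, map_add]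
    split_ifs with h
    · rw [Finset.sum_eq_single (b.1.degree, b.2.degree)]
      · simp
      · rintro ⟨a1, a2⟩ _ hne
        by_cases h1 : b.1.degree = a1
        · by_cases h2 : b.2.degree = a2
          · exact absurd (by rw [h1, h2]) hne
          · simp [h2]
        · simp [h1]
      · intro hh
        exact absurd (Finset.HasAntidiagonal.mem_antidiagonal.2 (by dsimp only; omega)) hh
    · refine Finset.sum_eq_zero fun a ha => ?_
      rw [Finset.HasAntidiagonal.mem_antidiagonal] at ha
      by_cases h1 : b.1.degree = a.1
      · rw [if_neg (c := b.2.degree = a.2) (by omega), mul_zero]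
      · rw [if_neg h1, zero_mul]
  rw [Finset.sum_congr rfl this]
  split_ifs <;> simp

theorem homogeneousComponent_psumHom (Q : MvPolynomial ℕ ℚ) (k : ℕ) :
    ∃ Q' : MvPolynomial ℕ ℚ, (psumHom Q' : MvPowerSeries ℕ ℚ) =
      MvPowerSeries.homogeneousComponent k (psumHom Q : MvPowerSeries ℕ ℚ) := by
  classical
  induction Q using MvPolynomial.induction_on generalizing k with
  | C r =>
    by_cases h : k = 0
    · refine ⟨MvPolynomial.C r, ?_⟩
      subst h
      ext e
      rw [MvPowerSeries.coeff_homogeneousComponent]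
      split_ifs with he
      · rfl
      · have : e ≠ 0 := by rintro rfl; simp at he
        simp [psumHom, MvPowerSeries.algebraMap_apply, MvPowerSeries.coeff_C, this]
    · refine ⟨0, ?_⟩
      ext e
      rw [MvPowerSeries.coeff_homogeneousComponent]
      split_ifs with he
      · have : e ≠ 0 := by rintro rfl; simp at he; omega
        simp [psumHom, MvPowerSeries.algebraMap_apply, MvPowerSeries.coeff_C, this]
      · simp
  | add p q hp hq =>
    obtain ⟨p', hp'⟩ := hp k
    obtain ⟨q', hq'⟩ := hq k
    exact ⟨p' + q', by simp [hp', hq']⟩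
  | mul_X p i hp =>
    have hX : ∀ j, ∃ Q' : MvPolynomial ℕ ℚ, (psumHom Q' : MvPowerSeries ℕ ℚ) =
        MvPowerSeries.homogeneousComponent j (psumSeries (i + 1)) := by
      intro j
      by_cases h : j = i + 1
      · refine ⟨MvPolynomial.X i, ?_⟩
        subst h
        ext e
        rw [MvPowerSeries.coeff_homogeneousComponent, psumHom, MvPolynomial.aeval_X, psum,
          coeff_psumSeries]
        by_cases he : ∃ a, e = Finsupp.single a (i + 1)
        · obtain ⟨a, rfl⟩ := he
          simp
        · rw [if_neg he, ite_self]
      · refine ⟨0, ?_⟩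
        ext e
        rw [MvPowerSeries.coeff_homogeneousComponent, coeff_psumSeries]
        by_cases he : ∃ a, e = Finsupp.single a (i + 1)
        · obtain ⟨a, rfl⟩ := he
          simp [Ne.symm h]
        · rw [if_neg he, ite_self]
          simp
    choose p' hp' using hp
    choose X' hX' using hX
    refine ⟨∑ a ∈ Finset.HasAntidiagonal.antidiagonal k, p' a.1 * X' a.2, ?_⟩
    have h1 : (psumHom (p * MvPolynomial.X i) : MvPowerSeries ℕ ℚ) =
        (psumHom p : MvPowerSeries ℕ ℚ) * psumSeries (i + 1) := by
      rw [map_mul]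
      simp [psumHom, psum]
    rw [h1, homogeneousComponent_mul, map_sum]
    simp [hp', hX']

theorem restrict_isSymmetric (n : ℕ) (f : SymmFun) : (restrict n f).IsSymmetric := by
  intro σ
  ext e
  obtain ⟨e', rfl⟩ : ∃ e', e = Finsupp.mapDomain σ e' :=
    ⟨Finsupp.mapDomain σ.symm e, by rw [← Finsupp.mapDomain_comp]; simp⟩
  rw [MvPolynomial.coeff_rename_mapDomain σ σ.injective, coeff_restrict, coeff_restrict,
    ← (renameEquiv_eq_self_iff (σ.viaEmbedding Fin.valEmbedding) f).1 (f.2.1 _)]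
  congr 1
  simp only [Finsupp.embDomain_eq_mapDomain, ← Finsupp.mapDomain_comp]
  congr 2
  funext x
  exact Equiv.Perm.viaEmbedding_apply σ Fin.valEmbedding x

theorem exists_perm_embDomain (n : ℕ) (e : ℕ →₀ ℕ) (he : e.degree ≤ n) :
    ∃ (σ : Equiv.Perm ℕ) (e' : Fin n →₀ ℕ),
      e.embDomain σ.toEmbedding = e'.embDomain Fin.valEmbedding := by
  classical
  have hcard : e.support.card ≤ n := by
    refine le_trans ?_ he
    rw [Finsupp.degree_apply, Finset.card_eq_sum_ones]
    exact Finset.sum_le_sum fun i hi => Nat.one_le_iff_ne_zero.2 (Finsupp.mem_support_iff.1 hi)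
  let t := Finset.range e.support.card
  let E1 : {x // x ∈ e.support} ≃ {x // x ∈ t} := Finset.equivOfCardEq (by simp [t])
  have i1 : Infinite {x // ¬ x ∈ e.support} := e.support.finite_toSet.infinite_compl.to_subtype
  have i2 : Infinite {x // ¬ x ∈ t} := t.finite_toSet.infinite_compl.to_subtype
  obtain ⟨E2⟩ := nonempty_equiv_of_countable (α := {x // ¬ x ∈ e.support}) (β := {x // ¬ x ∈ t})
  let σ : Equiv.Perm ℕ := Equiv.subtypeCongr E1 E2
  have hσ : ∀ x ∈ e.support, σ x < n := by
    intro x hx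
    have h1 : σ x = E1 ⟨x, hx⟩ := by
      simp [σ, Equiv.subtypeCongr, Equiv.sumCompl_symm_apply_of_pos (p := (· ∈ e.support)) hx]
    have h2 := (E1 ⟨x, hx⟩).2
    rw [Finset.mem_range] at h2
    omega
  have hr : e.embDomain σ.toEmbedding ∈ Set.range (Finsupp.embDomain (M := ℕ)
      (Fin.valEmbedding : Fin n ↪ ℕ)) := by
    rw [Finsupp.mem_range_embDomain_iff, Finsupp.support_embDomain]
    intro y hy
    simp only [Finset.coe_map, Set.mem_image, Finset.mem_coe] at hy
    obtain ⟨x, hx, rfl⟩ := hy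
    exact ⟨⟨σ x, hσ x hx⟩, rfl⟩
  obtain ⟨e', he'⟩ := hr
  exact ⟨σ, e', he'.symm⟩

theorem psumHom_surjective : Function.Surjective psumHom := by
  intro f
  obtain ⟨d, hd⟩ := f.2.2
  obtain ⟨Q, hQ⟩ := isSymmetric_mem_range d (restrict_isSymmetric d f)
  change MvPolynomial.aeval _ Q = _ at hQ
  rw [← restrict_psumHom_rename] at hQ
  set g := psumHom (MvPolynomial.rename Fin.val Q)
  have hlow : ∀ e : ℕ →₀ ℕ, e.degree ≤ d → MvPowerSeries.coeff e (g : MvPowerSeries ℕ ℚ) =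
      MvPowerSeries.coeff e (f : MvPowerSeries ℕ ℚ) := by
    intro e he
    obtain ⟨σ, e', hσ⟩ := exists_perm_embDomain d e he
    rw [← (renameEquiv_eq_self_iff σ _).1 (f.2.1 σ), ← (renameEquiv_eq_self_iff σ _).1 (g.2.1 σ),
      hσ, ← coeff_restrict, ← coeff_restrict, hQ]
  choose Q' hQ' using homogeneousComponent_psumHom (MvPolynomial.rename Fin.val Q)
  refine ⟨∑ k ∈ Finset.range (d + 1), Q' k, ?_⟩
  apply Subtype.ext
  rw [map_sum]
  ext e
  simp only [AddSubmonoidClass.coe_finsetSum, hQ', map_sum,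
    MvPowerSeries.coeff_homogeneousComponent, Finset.sum_ite_eq, Finset.mem_range]
  split_ifs with h
  · exact hlow e (by omega)
  · by_contra h2
    have := hd e (Ne.symm h2)
    omega

/-- `Λ(X)` is the polynomial ring over `ℚ` in the power sums `p₁, p₂, …`. -/
def psumEquiv : MvPolynomial ℕ ℚ ≃ₐ[ℚ] SymmFun :=
  AlgEquiv.ofBijective psumHom ⟨psumHom_injective, psumHom_surjective⟩

/-- The plethystic substitution prescribed by the values of the power sums: the unique
`ℚ`-algebra map `Λ(X) → A` sending `p_k` to `a k` for all `k ≥ 1`. -/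
def plethysm {A : Type*} [CommRing A] [Algebra ℚ A] (a : ℕ → A) : SymmFun →ₐ[ℚ] A :=
  (MvPolynomial.aeval fun m => a (m + 1)).comp psumEquiv.symm.toAlgHom

theorem plethysm_psum {A : Type*} [CommRing A] [Algebra ℚ A] (a : ℕ → A) {k : ℕ} (hk : 1 ≤ k) :
    plethysm a (psum k) = a k := by
  obtain ⟨m, rfl⟩ : ∃ m, k = m + 1 := ⟨k - 1, by omega⟩
  have : psumEquiv.symm (psum (m + 1)) = MvPolynomial.X m := by
    rw [AlgEquiv.symm_apply_eq]
    change _ = psumHom _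
    simp [psumHom]
  change MvPolynomial.aeval _ (psumEquiv.symm _) = _
  rw [this, MvPolynomial.aeval_X]

/-! ### Multi-symmetric functions -/

/-- The ring `Λ(X₁|⋯|X_r) = Λ(X₁) ⊗ ⋯ ⊗ Λ(X_r)` of multi-symmetric functions over `ℚ`. -/
def MultiSym (r : ℕ) : Type := ⨂[ℚ] _ : Fin r, SymmFun

instance instCommRingMultiSym (r : ℕ) : CommRing (MultiSym r) :=
  inferInstanceAs (CommRing (⨂[ℚ] _ : Fin r, SymmFun))

instance instAlgebraMultiSym (r : ℕ) : Algebra ℚ (MultiSym r) :=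
  inferInstanceAs (Algebra ℚ (⨂[ℚ] _ : Fin r, SymmFun))

/-- The function `f(X_j)` of the `j`-th alphabet alone. -/
def inAlphabet {r : ℕ} (j : Fin r) : SymmFun →ₐ[ℚ] MultiSym r :=
  PiTensorProduct.singleAlgHom (R := ℚ) (A := fun _ : Fin r => SymmFun) j

/-- Substitution in every alphabet: `f₁ ⊗ ⋯ ⊗ f_r ↦ φ₁(f₁) ⋯ φ_r(f_r)`. -/
def multiSubst {r : ℕ} {A : Type*} [CommRing A] [Algebra ℚ A] (φ : Fin r → SymmFun →ₐ[ℚ] A) :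
    MultiSym r →ₐ[ℚ] A :=
  PiTensorProduct.liftAlgHom (R := ℚ) (A := fun _ : Fin r => SymmFun)
    ((MultilinearMap.mkPiAlgebra ℚ (Fin r) A).compLinearMap fun j => (φ j).toLinearMap)
    (by simp) (by intro x y; simp [Finset.prod_mul_distrib])

/-! ### Isobaric divided differences -/

theorem sub_dvd_isobaric {σ : Type*} [DecidableEq σ] (x y : σ) (F : MvPolynomial σ ℚ) :
    (MvPolynomial.X x - MvPolynomial.X y : MvPolynomial σ ℚ) ∣
      MvPolynomial.X x * F - MvPolynomial.X y * MvPolynomial.rename (Equiv.swap x y) F := by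
  set d : MvPolynomial σ ℚ := MvPolynomial.X x - MvPolynomial.X y with hd
  have hxy : Ideal.Quotient.mkₐ ℚ (Ideal.span {d}) (MvPolynomial.X x) =
      Ideal.Quotient.mkₐ ℚ (Ideal.span {d}) (MvPolynomial.X y) := by
    rw [Ideal.Quotient.mkₐ_eq_mk, Ideal.Quotient.mk_eq_mk_iff_sub_mem]
    exact Ideal.mem_span_singleton_self d
  have h : (Ideal.Quotient.mkₐ ℚ (Ideal.span {d})).comp (MvPolynomial.rename (Equiv.swap x y)) =
      Ideal.Quotient.mkₐ ℚ (Ideal.span {d}) := by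
    ext1 i
    rw [AlgHom.comp_apply, MvPolynomial.rename_X]
    by_cases h1 : i = x
    · rw [h1, Equiv.swap_apply_left, hxy]
    · by_cases h2 : i = y
      · rw [h2, Equiv.swap_apply_right, hxy]
      · rw [Equiv.swap_apply_of_ne_of_ne h1 h2]
  rw [← Ideal.mem_span_singleton, ← Ideal.Quotient.eq_zero_iff_mem,
    ← Ideal.Quotient.mkₐ_eq_mk ℚ, map_sub, map_mul, map_mul, hxy]
  have h3 := DFunLike.congr_fun h F
  rw [AlgHom.comp_apply] at h3
  rw [h3, sub_self]

/-- The isobaric divided difference operator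
`ξ_{x,y}(F) = (x F(x,y) - y F(y,x)) / (x - y)`, for distinct variables `x`, `y`. -/
def isobaric {σ : Type*} [DecidableEq σ] (x y : σ) (F : MvPolynomial σ ℚ) : MvPolynomial σ ℚ :=
  (sub_dvd_isobaric x y F).choose

theorem isobaric_spec {σ : Type*} [DecidableEq σ] (x y : σ) (F : MvPolynomial σ ℚ) :
    MvPolynomial.X x * F - MvPolynomial.X y * MvPolynomial.rename (Equiv.swap x y) F =
      (MvPolynomial.X x - MvPolynomial.X y) * isobaric x y F :=
  (sub_dvd_isobaric x y F).choose_spec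

/-- For a list of variables `y₀, y₁, …, y_m`, the composite
`ξ_{y_{m-1},y_m} ⋯ ξ_{y₁,y₂} ξ_{y₀,y₁}` (the rightmost operator acts first). -/
def isobaricChain {σ : Type*} [DecidableEq σ] :
    List σ → MvPolynomial σ ℚ → MvPolynomial σ ℚ
  | x :: y :: l, F => isobaricChain (y :: l) (isobaric x y F)
  | _, F => F

/-! ### The operators in finitely many variables and their stable limit -/

/-- The index of the next alphabet. -/
def next {r : ℕ} (i : Fin r) (hi : (i : ℕ) + 1 < r) : Fin r := ⟨i + 1, hi⟩

/-- Names `(j, k)` of the variables `x_{j,k}`, with `n j` variables in the `j`-th alphabet. -/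
abbrev Var {r : ℕ} (n : Fin r → ℕ) : Type := Σ j : Fin r, Fin (n j)

/-- The restriction `f(X₁^{(n₁)}|⋯|X_r^{(n_r)})` of a multi-symmetric function to finitely many
variables. -/
def finRestrict {r : ℕ} (n : Fin r → ℕ) : MultiSym r →ₐ[ℚ] MvPolynomial (Var n) ℚ :=
  multiSubst fun j => evalAt fun k : Fin (n j) => MvPolynomial.X (⟨j, k⟩ : Var n)

/-- The polynomial `f(X₁^{(n₁)}|⋯|X_i^{(n_i)} + z|⋯|X_r^{(n_r)})`; the variable `z` is `none`. -/
def addVar {r : ℕ} (i : Fin r) (n : Fin r → ℕ) :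
    MultiSym r →ₐ[ℚ] MvPolynomial (Option (Var n)) ℚ :=
  multiSubst fun j =>
    if j = i then
      evalAt (Fin.snoc (fun k : Fin (n j) => MvPolynomial.X (some (⟨j, k⟩ : Var n)))
        (MvPolynomial.X none) : Fin (n j + 1) → MvPolynomial (Option (Var n)) ℚ)
    else evalAt fun k : Fin (n j) => MvPolynomial.X (some (⟨j, k⟩ : Var n))

/-- The operator
`D_i^{(n₁|⋯|n_r)} f = ⟨z⁰⟩ ξ^{(i+1)}_{n_{i+1}-1} ⋯ ξ^{(i+1)}_1 ξ_{z,x_{i+1,1}} f(⋯|X_i^{(n_i)}+z|⋯)`. -/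
def finD {r : ℕ} (i : Fin r) (hi : (i : ℕ) + 1 < r) (n : Fin r → ℕ) (f : MultiSym r) :
    MvPolynomial (Var n) ℚ :=
  (MvPolynomial.optionEquivLeft ℚ (Var n)
    (isobaricChain
      (none :: List.ofFn fun k : Fin (n (next i hi)) => some (⟨next i hi, k⟩ : Var n))
      (addVar i n f))).coeff 0

/-- `g` is the stable limit of the family `F` of polynomials in finitely many variables. -/
def IsStableLimit {r : ℕ} (F : (n : Fin r → ℕ) → MvPolynomial (Var n) ℚ) (g : MultiSym r) : Prop :=
  ∀ n : Fin r → ℕ, (∀ j, 1 ≤ n j) → finRestrict n g = F n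

/-- The operator `D_i f = lim D_i^{(n₁|⋯|n_r)} f` (zero if there is no stable limit). -/
def D {r : ℕ} (i : Fin r) (hi : (i : ℕ) + 1 < r) (f : MultiSym r) : MultiSym r :=
  open Classical in
  if h : ∃ g, IsStableLimit (fun n => finD i hi n f) g then h.choose else 0

/-! ### The plethystic side -/

/-- The power `z ^ a` in the ring of formal Laurent series in `z` over `Λ(X₁|⋯|X_r)`. -/
def zPow (r : ℕ) (a : ℤ) : LaurentSeries (MultiSym r) := HahnSeries.single a 1

/-- `f(X₁|⋯|X_i + z^{-1}|X_{i+1} - z^{-1}|⋯|X_r)`: the power sums are substituted by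
`p_k(X_i) + z^{-k}`, `p_k(X_{i+1}) - z^{-k}` and `p_k(X_j)` for `j ≠ i, i + 1`. -/
def shift {r : ℕ} (i : Fin r) (hi : (i : ℕ) + 1 < r) : MultiSym r →ₐ[ℚ] LaurentSeries (MultiSym r) :=
  multiSubst fun j => plethysm fun k =>
    if j = i then HahnSeries.C (inAlphabet j (psum k)) + zPow r (-k)
    else if j = next i hi then HahnSeries.C (inAlphabet j (psum k)) - zPow r (-k)
    else HahnSeries.C (inAlphabet j (psum k))

/-- `Ω(z X_j)`: the component of degree `k` of `Ω(X_j)` is multiplied by `z ^ k`. -/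
def OmegaZ {r : ℕ} (j : Fin r) : LaurentSeries (MultiSym r) :=
  HahnSeries.ofPowerSeries ℤ (MultiSym r) (PowerSeries.mk fun k => inAlphabet j (OmegaPart k))

end PlethysticOperators

end

noncomputable section

namespace PlethysticOperators

/-! ### Homomorphisms out of rings of symmetric functions -/

/-! Write f(⋯|X_i + t|X_{i+1} - t|⋯) = ∑ f_a t^a, a finite sum with coefficients f_a in Λ(X₁|⋯|X_r)
(`polyShift`). Putting t = z and replacing X_{i+1} by X_{i+1} + z cancels the subtraction, so
f(⋯|X_i + z|X_{i+1}|⋯) = ∑ f_a(⋯|X_{i+1} + z|⋯) z^a (`addVar_eq_eval₂`). Each factor f_a(⋯|X_{i+1} +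
z|⋯) is symmetric in z and the variables of X_{i+1}, hence commutes with the operators ξ
(`rename_swap_addVar`, `isobaricChain_mul`). They act on z^a alone and turn it into h_a(z, X_{i+1})
(`isobaricChain_X_pow`). Taking the coefficient of z⁰ means setting z = 0, which leaves ∑ f_a
h_a(X_{i+1}). This does not depend on the numbers of variables, so it is a stable limit
(`finRestrict_shiftOmega`). It is also the z⁰ coefficient of (∑ f_a z^{-a}) Ω(zX_{i+1})
(`coeff_shift_mul_OmegaZ`). Uniqueness holds because power sums generate Λ(X₁|⋯|X_r), and p₁, …, p_N
of each alphabet remain algebraically independent in N variables per alphabet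
(`eq_zero_of_finRestrict`). -/

theorem symmFun_algHom_ext {A : Type*} [CommRing A] [Algebra ℚ A] {φ ψ : SymmFun →ₐ[ℚ] A}
    (h : ∀ k, 1 ≤ k → φ (psum k) = ψ (psum k)) : φ = ψ := by
  have h' : φ.comp psumHom = ψ.comp psumHom := by
    ext m
    simpa [psumHom] using h (m + 1) (by omega)
  ext f
  obtain ⟨Q, rfl⟩ := psumHom_surjective f
  exact DFunLike.congr_fun h' Q

theorem multiSubst_inAlphabet {r : ℕ} {A : Type*} [CommRing A] [Algebra ℚ A]
    (φ : Fin r → SymmFun →ₐ[ℚ] A) (j : Fin r) (f : SymmFun) :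
    multiSubst φ (inAlphabet j f) = φ j f := by
  have h : multiSubst φ (inAlphabet j f) =
      ∏ a, φ a ((Pi.mulSingle j f : Fin r → SymmFun) a) :=
    PiTensorProduct.lift.tprod _
  rw [h, Finset.prod_eq_single j]
  · simp
  · intro b _ hb
    simp [Pi.mulSingle_eq_of_ne hb]
  · simp

/-- Reduces each identity between substitutions below to a check on the power sums of a single
alphabet. -/
theorem multiSym_algHom_ext {r : ℕ} {A : Type*} [CommRing A] [Algebra ℚ A]
    {φ ψ : MultiSym r →ₐ[ℚ] A}
    (h : ∀ j k, 1 ≤ k → φ (inAlphabet j (psum k)) = ψ (inAlphabet j (psum k))) : φ = ψ :=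
  PiTensorProduct.algHom_ext (R := ℚ) (A := fun _ : Fin r => SymmFun) fun j =>
    symmFun_algHom_ext fun k hk => h j k hk

theorem evalAt_psum {A : Type*} [CommRing A] [Algebra ℚ A] {n : ℕ} (a : Fin n → A) {k : ℕ}
    (hk : 1 ≤ k) : evalAt a (psum k) = ∑ m, a m ^ k := by
  rw [evalAt, AlgHom.comp_apply, restrict_psum n (by omega), MvPolynomial.psum, map_sum]
  simp

theorem restrict_OmegaPart (n k : ℕ) : restrict n (OmegaPart k) =
    ∑ e ∈ Finset.finsuppAntidiag Finset.univ k, MvPolynomial.monomial e 1 := by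
  classical
  ext e
  rw [coeff_restrict, OmegaPart, MvPowerSeries.coeff_homogeneousComponent, degree_embDomain,
    MvPolynomial.coeff_sum]
  simp only [MvPolynomial.coeff_monomial, Finset.sum_ite_eq', Finset.mem_finsuppAntidiag]
  refine if_congr ?_ rfl rfl
  simp [Finsupp.degree_eq_sum]

/-- The generating function of the complete homogeneous h_k is ∏ 1/(1 - a_m t). The factors are kept
as geometric series to match `isobaricChain_X_pow`. -/
theorem evalAt_OmegaPart {A : Type*} [CommRing A] [Algebra ℚ A] {n : ℕ} (a : Fin n → A) (k : ℕ) :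
    evalAt a (OmegaPart k) =
      PowerSeries.coeff k (∏ m, PowerSeries.mk fun b => a m ^ b) := by
  classical
  rw [evalAt, AlgHom.comp_apply, restrict_OmegaPart, map_sum, PowerSeries.coeff_prod]
  refine Finset.sum_congr rfl fun e _ => ?_
  simp [MvPolynomial.aeval_monomial, Finsupp.prod_fintype]

/-! ### Isobaric divided differences -/

section Isobaric

variable {σ : Type*} [DecidableEq σ]

/-- `isobaric` is a chosen quotient. Only for x ≠ y is the divisor nonzero, and the quotient then
unique in the polynomial domain. -/
theorem isobaric_eq_of_mul_eq {x y : σ} (hxy : x ≠ y) {F G : MvPolynomial σ ℚ}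
    (h : MvPolynomial.X x * F - MvPolynomial.X y * MvPolynomial.rename (Equiv.swap x y) F =
      (MvPolynomial.X x - MvPolynomial.X y) * G) : isobaric x y F = G := by
  have hne : (MvPolynomial.X x - MvPolynomial.X y : MvPolynomial σ ℚ) ≠ 0 :=
    sub_ne_zero.2 fun hh => hxy (MvPolynomial.X_injective hh)
  exact mul_left_cancel₀ hne ((isobaric_spec x y F).symm.trans h)

theorem isobaric_sum {ι : Type*} {x y : σ} (hxy : x ≠ y) (s : Finset ι)
    (F : ι → MvPolynomial σ ℚ) :
    isobaric x y (∑ a ∈ s, F a) = ∑ a ∈ s, isobaric x y (F a) := by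
  refine isobaric_eq_of_mul_eq hxy ?_
  rw [map_sum, Finset.mul_sum, Finset.mul_sum, Finset.mul_sum, ← Finset.sum_sub_distrib]
  exact Finset.sum_congr rfl fun a _ => isobaric_spec x y (F a)

theorem isobaric_mul {x y : σ} (hxy : x ≠ y) {s : MvPolynomial σ ℚ}
    (hs : MvPolynomial.rename (Equiv.swap x y) s = s) (F : MvPolynomial σ ℚ) :
    isobaric x y (s * F) = s * isobaric x y F := by
  refine isobaric_eq_of_mul_eq hxy ?_
  rw [map_mul, hs]
  linear_combination s * isobaric_spec x y F

/-- The numerator is x^(a+1) - y^(a+1), so this is the finite geometric sum. -/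
theorem isobaric_X_pow {x y : σ} (hxy : x ≠ y) (a : ℕ) :
    isobaric x y (MvPolynomial.X x ^ a) = ∑ b ∈ Finset.HasAntidiagonal.antidiagonal a,
      MvPolynomial.X x ^ b.1 * MvPolynomial.X y ^ b.2 := by
  refine isobaric_eq_of_mul_eq hxy ?_
  rw [map_pow, MvPolynomial.rename_X, Equiv.swap_apply_left,
    Finset.Nat.sum_antidiagonal_eq_sum_range_succ_mk, mul_comm (_ - _), ← pow_succ', ← pow_succ']
  exact (Commute.geom_sum₂_mul (Commute.all _ _) (a + 1)).symm

theorem isobaricChain_sum {ι : Type*} (s : Finset ι) {l : List σ} (hl : l.Nodup)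
    (F : ι → MvPolynomial σ ℚ) :
    isobaricChain l (∑ a ∈ s, F a) = ∑ a ∈ s, isobaricChain l (F a) := by
  induction l generalizing F with
  | nil => rfl
  | cons x l ih =>
    cases l with
    | nil => rfl
    | cons y l =>
      have hxy : x ≠ y := fun h => (List.nodup_cons.1 hl).1 (h ▸ List.mem_cons_self)
      simp only [isobaricChain]
      rw [isobaric_sum hxy, ih (List.nodup_cons.1 hl).2]

/-- Each divided difference is linear over the polynomials fixed by its swap, so a factor symmetric
in the variables of the list passes through the whole chain. -/
theorem isobaricChain_mul {l : List σ} (hl : l.Nodup) {s : MvPolynomial σ ℚ}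
    (hs : ∀ x ∈ l, ∀ y ∈ l, MvPolynomial.rename (Equiv.swap x y) s = s) (F : MvPolynomial σ ℚ) :
    isobaricChain l (s * F) = s * isobaricChain l F := by
  induction l generalizing F with
  | nil => rfl
  | cons x l ih =>
    cases l with
    | nil => rfl
    | cons y l =>
      have hxy : x ≠ y := fun h => (List.nodup_cons.1 hl).1 (h ▸ List.mem_cons_self)
      simp only [isobaricChain]
      rw [isobaric_mul hxy (hs x List.mem_cons_self y (by simp)),
        ih (List.nodup_cons.1 hl).2 fun u hu v hv =>
          hs u (List.mem_cons_of_mem _ hu) v (List.mem_cons_of_mem _ hv)]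

/-- The operators `ξ` turn a power of the first variable into a complete homogeneous symmetric
polynomial in all the variables. -/
theorem isobaricChain_X_pow (x : σ) {l : List σ} (hl : (x :: l).Nodup) (a : ℕ) :
    isobaricChain (x :: l) (MvPolynomial.X x ^ a : MvPolynomial σ ℚ) = PowerSeries.coeff a
      ((x :: l).map fun v => PowerSeries.mk fun b => (MvPolynomial.X v ^ b : MvPolynomial σ ℚ)).prod := by
  induction l generalizing x a with
  | nil => simp [isobaricChain]
  | cons y l ih =>
    have hx := (List.nodup_cons.1 hl).1
    have hl' := (List.nodup_cons.1 hl).2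
    have hxy : x ≠ y := fun h => hx (h ▸ List.mem_cons_self)
    -- The first operator gives ∑ x^b y^c with b + c = a. The later ones do not move x, so x^b
    -- factors out and induction handles y^c; the result is the Cauchy product for the coefficient
    -- of degree a.
    rw [isobaricChain, isobaric_X_pow hxy, isobaricChain_sum _ hl', List.map_cons, List.prod_cons,
      PowerSeries.coeff_mul]
    refine Finset.sum_congr rfl fun b _ => ?_
    rw [isobaricChain_mul hl', ih y hl', PowerSeries.coeff_mk]
    intro u hu v hv
    rw [map_pow, MvPolynomial.rename_X, Equiv.swap_apply_of_ne_of_ne]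
    · exact fun h => hx (h ▸ hu)
    · exact fun h => hx (h ▸ hv)

end Isobaric

/-! ### Restriction to finitely many variables is jointly injective -/

theorem finRestrict_psum {r : ℕ} (n : Fin r → ℕ) (j : Fin r) {k : ℕ} (hk : 1 ≤ k) :
    finRestrict n (inAlphabet j (psum k)) =
      ∑ m : Fin (n j), (MvPolynomial.X ⟨j, m⟩ : MvPolynomial (Var n) ℚ) ^ k := by
  rw [finRestrict, multiSubst_inAlphabet, evalAt_psum _ hk]

/-- The substitution of the power sums of the alphabets `j ∈ S` for their variables. -/
def psumSubst (r N : ℕ) (S : Finset (Fin r)) :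
    MvPolynomial (Fin r × Fin N) ℚ →ₐ[ℚ] MvPolynomial (Fin r × Fin N) ℚ :=
  MvPolynomial.aeval fun v =>
    if v.1 ∈ S then ∑ m, MvPolynomial.X (v.1, m) ^ ((v.2 : ℕ) + 1) else MvPolynomial.X v

/-- A polynomial over the infinite field ℚ is determined by its values. Freezing the other alphabets
at rational numbers reduces the claim to the algebraic independence of p₁, …, p_N in N variables. -/
theorem psumSubst_singleton_injective (r N : ℕ) (j : Fin r) :
    Function.Injective (psumSubst r N {j}) := by
  rw [injective_iff_map_eq_zero]
  intro F hF
  refine MvPolynomial.funext fun v => ?_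
  let spec : MvPolynomial (Fin r × Fin N) ℚ →ₐ[ℚ] MvPolynomial (Fin N) ℚ :=
    MvPolynomial.aeval fun w =>
      if w.1 = j then MvPolynomial.X w.2 else MvPolynomial.C (v w)
  -- Freezing the other alphabets commutes with the substitution, which only touches alphabet `j`.
  have h1 : (MvPolynomial.aeval (R := ℚ) fun m : Fin N =>
      MvPolynomial.psum (Fin N) ℚ (m + 1)).comp spec = spec.comp (psumSubst r N {j}) := by
    ext1 w
    by_cases hw : w.1 = j
    · simp [spec, psumSubst, hw, MvPolynomial.psum]
    · simp [spec, psumSubst, hw]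
  have h2 : spec F = 0 := by
    apply aeval_psum_fin_injective N
    rw [map_zero, ← AlgHom.comp_apply, h1, AlgHom.comp_apply, hF, map_zero]
  have h3 : (MvPolynomial.aeval fun m => v (j, m)).comp spec = MvPolynomial.aeval (R := ℚ) v := by
    ext1 w
    obtain ⟨a, b⟩ := w
    by_cases hw : a = j
    · subst hw; simp [spec]
    · simp [spec, hw]
  have h4 := DFunLike.congr_fun h3 F
  rw [AlgHom.comp_apply, h2, map_zero, MvPolynomial.aeval_eq_eval] at h4
  rw [map_zero]
  exact h4.symm

theorem psumSubst_injective (r N : ℕ) (S : Finset (Fin r)) :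
    Function.Injective (psumSubst r N S) := by
  classical
  induction S using Finset.induction_on with
  | empty =>
    have : psumSubst r N ∅ = AlgHom.id ℚ _ := by ext1 v; simp [psumSubst]
    rw [this]
    exact fun _ _ h => h
  | insert j S hj ih =>
    -- The power sums of alphabets in `S` involve no variable of alphabet `j`, so the second
    -- substitution leaves them alone.
    have : psumSubst r N (insert j S) = (psumSubst r N {j}).comp (psumSubst r N S) := by
      ext1 v
      by_cases h1 : v.1 ∈ S
      · have h2 : v.1 ≠ j := fun h => hj (h ▸ h1)
        simp [psumSubst, h1, h2]
      · by_cases h2 : v.1 = j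
        · simp [psumSubst, hj, h2]
        · simp [psumSubst, h1, h2]
    rw [this, AlgHom.coe_comp]
    exact (psumSubst_singleton_injective r N j).comp ih

/-- The algebra map sending the variable `(j, m)` to the power sum `p_{m+1}(X_j)`. -/
def multiPsumHom (r : ℕ) : MvPolynomial (Fin r × ℕ) ℚ →ₐ[ℚ] MultiSym r :=
  MvPolynomial.aeval fun v => inAlphabet v.1 (psum (v.2 + 1))

theorem multiPsumHom_surjective (r : ℕ) : Function.Surjective (multiPsumHom r) := by
  let ψ : MultiSym r →ₐ[ℚ] MvPolynomial (Fin r × ℕ) ℚ :=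
    -- A right inverse of `multiPsumHom`: the variable (j, m) stands for p_{m+1}, hence the index k
    -- - 1. The value at k = 0 is never used by `plethysm`.
    multiSubst fun j => plethysm fun k => MvPolynomial.X (j, k - 1)
  have h : (multiPsumHom r).comp ψ = AlgHom.id ℚ _ := by
    refine multiSym_algHom_ext fun j k hk => ?_
    rw [AlgHom.comp_apply, multiSubst_inAlphabet, plethysm_psum _ hk]
    simp [multiPsumHom, Nat.sub_add_cancel hk]
  exact fun f => ⟨ψ f, DFunLike.congr_fun h f⟩

theorem eq_zero_of_finRestrict {r : ℕ} {g : MultiSym r}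
    (hg : ∀ n : Fin r → ℕ, (∀ j, 1 ≤ n j) → finRestrict n g = 0) : g = 0 := by
  obtain ⟨Q, rfl⟩ := multiPsumHom_surjective r g
  -- With this N, only p₁, …, p_N of each alphabet occur, so N variables per alphabet suffice.
  obtain ⟨N, hN, hQN⟩ : ∃ N, 1 ≤ N ∧ ∀ v ∈ Q.vars, v.2 < N :=
    ⟨Q.vars.sup Prod.snd + 1, by omega, fun v hv => Nat.lt_succ_of_le
      (Finset.le_sup (f := Prod.snd) hv)⟩
  obtain ⟨Q', rfl⟩ := MvPolynomial.exists_rename_eq_of_vars_subset_range Q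
    (Prod.map id Fin.val : Fin r × Fin N → Fin r × ℕ)
    (Function.injective_id.prodMap Fin.val_injective)
    (fun v hv => ⟨(v.1, ⟨v.2, hQN v hv⟩), rfl⟩)
  let E : Var (fun _ : Fin r => N) → Fin r × Fin N := fun v => (v.1, v.2)
  have h1 : (((MvPolynomial.rename E).comp (finRestrict fun _ => N)).comp (multiPsumHom r)).comp
      (MvPolynomial.rename (Prod.map id Fin.val)) = psumSubst r N Finset.univ := by
    ext1 v
    simp [multiPsumHom, psumSubst, finRestrict_psum, E]
  have h2 : psumSubst r N Finset.univ Q' = 0 := by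
    rw [← h1]
    simp only [AlgHom.comp_apply]
    rw [hg _ fun _ => hN, map_zero]
  rw [psumSubst_injective r N _ (h2.trans (map_zero _).symm), map_zero, map_zero]

/-! ### Splitting off a variable -/

/-- `f(X₁|⋯|X_i + t|X_{i+1} - t|⋯|X_r)` as a polynomial in `t`. -/
def polyShift {r : ℕ} (i : Fin r) (hi : (i : ℕ) + 1 < r) :
    MultiSym r →ₐ[ℚ] Polynomial (MultiSym r) :=
  multiSubst fun j => plethysm fun k =>
    if j = i then Polynomial.C (inAlphabet j (psum k)) + Polynomial.X ^ k
    else if j = next i hi then Polynomial.C (inAlphabet j (psum k)) - Polynomial.X ^ k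
    else Polynomial.C (inAlphabet j (psum k))

/-- The explicit value of `D_i f`: the sum over `a` of the coefficient of `t ^ a` in
`f(X₁|⋯|X_i + t|X_{i+1} - t|⋯|X_r)` times the component of degree `a` of `Ω(X_{i+1})`. -/
def shiftOmega {r : ℕ} (i : Fin r) (hi : (i : ℕ) + 1 < r) (f : MultiSym r) : MultiSym r :=
  (polyShift i hi f).sum fun a t => t * inAlphabet (next i hi) (OmegaPart a)

theorem next_ne {r : ℕ} (i : Fin r) (hi : (i : ℕ) + 1 < r) : next i hi ≠ i := by
  intro h
  have := congrArg Fin.val h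
  simp [next] at this

theorem zPow_neg_pow (r k : ℕ) : zPow r (-1) ^ k = zPow r (-k) := by
  simp [zPow, HahnSeries.single_pow]

/-- The Laurent-series substitution is the polynomial one at t = z⁻¹, so only finitely many powers
of z occur and coefficient extraction becomes a finite sum. -/
theorem shift_eq_eval₂ {r : ℕ} (i : Fin r) (hi : (i : ℕ) + 1 < r) (f : MultiSym r) :
    shift i hi f = (polyShift i hi f).eval₂ HahnSeries.C (zPow r (-1)) := by
  have h : shift i hi = (Polynomial.eval₂AlgHom (RingHom.toRatAlgHom HahnSeries.C) (zPow r (-1))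
      fun _ => Commute.all _ _).comp (polyShift i hi) := by
    refine multiSym_algHom_ext fun j k hk => ?_
    rw [AlgHom.comp_apply, shift, polyShift, multiSubst_inAlphabet, multiSubst_inAlphabet,
      plethysm_psum _ hk, plethysm_psum _ hk, Polynomial.eval₂AlgHom_apply]
    split_ifs <;> simp [zPow_neg_pow]
  rw [h]
  rfl

/-- The term f_a z^{-a} picks out the coefficient of z^a in Ω(zX_{i+1}). -/
theorem coeff_shift_mul_OmegaZ {r : ℕ} (i : Fin r) (hi : (i : ℕ) + 1 < r) (f : MultiSym r) :
    (shift i hi f * OmegaZ (next i hi)).coeff 0 = shiftOmega i hi f := by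
  rw [shift_eq_eval₂, Polynomial.eval₂_eq_sum, Polynomial.sum, Finset.sum_mul,
    HahnSeries.coeff_sum, shiftOmega, Polynomial.sum]
  refine Finset.sum_congr rfl fun a _ => ?_
  rw [zPow_neg_pow, zPow, HahnSeries.C_apply, HahnSeries.single_mul_single, zero_add, mul_one]
  have h := HahnSeries.coeff_single_mul_add (r := (polyShift i hi f).coeff a)
    (x := OmegaZ (next i hi)) (a := (a : ℤ)) (b := -(a : ℤ))
  rw [add_neg_cancel] at h
  rw [h, OmegaZ]
  congr 1
  rw [HahnSeries.ofPowerSeries_apply_coeff, PowerSeries.coeff_mk]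

/-- The restriction `f(X₁^{(n₁)}|⋯|X_j^{(n_j)} + z|⋯|X_r^{(n_r)})` on power sums. -/
theorem addVar_psum {r : ℕ} (i : Fin r) (n : Fin r → ℕ) (j : Fin r) {k : ℕ} (hk : 1 ≤ k) :
    addVar i n (inAlphabet j (psum k)) =
      (∑ m : Fin (n j), (MvPolynomial.X (some ⟨j, m⟩) : MvPolynomial (Option (Var n)) ℚ) ^ k) +
        if j = i then MvPolynomial.X none ^ k else 0 := by
  rw [addVar, multiSubst_inAlphabet]
  split_ifs with h
  · rw [evalAt_psum _ hk, Fin.sum_univ_castSucc]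
    simp
  · rw [evalAt_psum _ hk, add_zero]

/-- X_{i+1} = (X_{i+1} + z) - z. This moves the extra variable from alphabet i to alphabet i + 1,
where the coefficients become symmetric in it, at the cost of explicit powers of z. -/
theorem addVar_eq_eval₂ {r : ℕ} (i : Fin r) (hi : (i : ℕ) + 1 < r) (n : Fin r → ℕ)
    (f : MultiSym r) : addVar i n f = (polyShift i hi f).eval₂
      (addVar (next i hi) n : MultiSym r →+* MvPolynomial (Option (Var n)) ℚ)
      (MvPolynomial.X none) := by
  have h : addVar i n = (Polynomial.eval₂AlgHom (addVar (next i hi) n) (MvPolynomial.X none)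
      fun _ => Commute.all _ _).comp (polyShift i hi) := by
    refine multiSym_algHom_ext fun j k hk => ?_
    rw [AlgHom.comp_apply, polyShift, multiSubst_inAlphabet, plethysm_psum _ hk, 
      Polynomial.eval₂AlgHom_apply, addVar_psum i n j hk]
    have hne := next_ne i hi
    split_ifs with h1 h2
    · subst h1
      simp [addVar_psum _ n j hk, hne.symm]
    · subst h2
      simp [addVar_psum _ n _ hk]
    · simp [addVar_psum _ n j hk, h2]
  conv_lhs => rw [h]
  rfl

/-- The added variable is on the same footing as the others of its alphabet; `Option (Fin (n i))`
indexes the enlarged alphabet. On power sums a swap only permutes the summands. -/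
theorem rename_swap_addVar {r : ℕ} (i : Fin r) (n : Fin r → ℕ) (x y : Option (Fin (n i)))
    (f : MultiSym r) :
    MvPolynomial.rename (Equiv.swap (x.map fun m => (⟨i, m⟩ : Var n))
      (y.map fun m => (⟨i, m⟩ : Var n))) (addVar i n f) = addVar i n f := by
  let ι : Option (Fin (n i)) → Option (Var n) := Option.map fun m => ⟨i, m⟩
  have hι : Function.Injective ι := Option.map_injective (sigma_mk_injective (β := fun j => Fin (n j)) (i := i))
  have h : (MvPolynomial.rename (Equiv.swap (ι x) (ι y))).comp (addVar i n) = addVar i n := by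
    refine multiSym_algHom_ext fun j k hk => ?_
    rw [AlgHom.comp_apply, addVar_psum i n j hk]
    by_cases hj : j = i
    · subst hj
      have hsum : (∑ m : Fin (n j), (MvPolynomial.X (some ⟨j, m⟩) :
          MvPolynomial (Option (Var n)) ℚ) ^ k) + (MvPolynomial.X none) ^ k =
          ∑ v, MvPolynomial.X (ι v) ^ k := by
        rw [Fintype.sum_option, add_comm]
        rfl
      rw [if_pos rfl, hsum, map_sum, ← Equiv.sum_comp (Equiv.swap x y)]
      refine Finset.sum_congr rfl fun v _ => ?_
      rw [map_pow, MvPolynomial.rename_X, hι.swap_apply, Equiv.swap_apply_self]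
    · rw [if_neg hj, add_zero, map_sum]
      refine Finset.sum_congr rfl fun m _ => ?_
      have hne : ∀ v, (some ⟨j, m⟩ : Option (Var n)) ≠ ι v := by
        intro v hv
        cases v with
        | none => simp [ι] at hv
        | some v =>
          simp only [ι, Option.map_some, Option.some.injEq, Sigma.mk.injEq] at hv
          exact hj hv.1
      rw [map_pow, MvPolynomial.rename_X, Equiv.swap_apply_of_ne_of_ne (hne x) (hne y)]
  exact DFunLike.congr_fun h f

/-! ### The stable limit -/

/-- Taking the coefficient of `z⁰` is setting `z = 0`. -/
theorem optionEquivLeft_coeff_zero {σ : Type*} (F : MvPolynomial (Option σ) ℚ) :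
    (MvPolynomial.optionEquivLeft ℚ σ F).coeff 0 =
      MvPolynomial.aeval (fun v : Option σ => v.elim 0 MvPolynomial.X) F := by
  have h : ((Polynomial.aeval (0 : MvPolynomial σ ℚ)).restrictScalars ℚ).comp
      (MvPolynomial.optionEquivLeft ℚ σ).toAlgHom =
      MvPolynomial.aeval (fun v : Option σ => v.elim 0 MvPolynomial.X) := by
    ext1 v
    cases v <;> simp
  rw [← h]
  simp [Polynomial.coeff_zero_eq_aeval_zero]

theorem aeval_addVar {r : ℕ} (i : Fin r) (n : Fin r → ℕ) (f : MultiSym r) :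
    MvPolynomial.aeval (fun v : Option (Var n) => v.elim 0 MvPolynomial.X) (addVar i n f) =
      finRestrict n f := by
  have h : (MvPolynomial.aeval (fun v : Option (Var n) => v.elim 0 MvPolynomial.X)).comp
      (addVar i n) = finRestrict n := by
    refine multiSym_algHom_ext fun j k hk => ?_
    rw [AlgHom.comp_apply, addVar_psum i n j hk, finRestrict_psum n j hk]
    split_ifs <;> simp [show k ≠ 0 by omega]
  exact DFunLike.congr_fun h f

theorem finRestrict_shiftOmega {r : ℕ} (i : Fin r) (hi : (i : ℕ) + 1 < r) (n : Fin r → ℕ)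
    (f : MultiSym r) : finRestrict n (shiftOmega i hi f) = finD i hi n f := by
  let j := next i hi
  let l : List (Option (Var n)) := List.ofFn fun k : Fin (n j) => some (⟨j, k⟩ : Var n)
  have hl : (none :: l).Nodup := by
    refine List.nodup_cons.2 ⟨by simp [l, List.mem_ofFn], List.nodup_ofFn.2 ?_⟩
    exact (Option.some_injective _).comp sigma_mk_injective
  have hmem : ∀ x ∈ none :: l, ∃ v : Option (Fin (n j)), x = v.map fun m => (⟨j, m⟩ : Var n) := by
    intro x hx
    rcases List.mem_cons.1 hx with rfl | hx
    · exact ⟨none, rfl⟩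
    · obtain ⟨k, rfl⟩ := List.mem_ofFn.1 hx
      exact ⟨some k, rfl⟩
  have hinv : ∀ (g : MultiSym r), ∀ x ∈ none :: l, ∀ y ∈ none :: l,
      MvPolynomial.rename (Equiv.swap x y) (addVar j n g) = addVar j n g := by
    intro g x hx y hy
    obtain ⟨u, rfl⟩ := hmem x hx
    obtain ⟨v, rfl⟩ := hmem y hy
    exact rename_swap_addVar j n u v g
  -- The chain sends z^a to h_a(z, X_{i+1}). At z = 0 the geometric series of z becomes 1 (`h0`),
  -- leaving h_a(X_{i+1}).
  have hΩ : ∀ a, MvPolynomial.aeval (fun v : Option (Var n) => v.elim 0 MvPolynomial.X)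
      (isobaricChain (none :: l) (MvPolynomial.X none ^ a : MvPolynomial (Option (Var n)) ℚ)) =
      finRestrict n (inAlphabet j (OmegaPart a)) := by
    intro a
    rw [isobaricChain_X_pow none hl, finRestrict, multiSubst_inAlphabet, evalAt_OmegaPart,
      ← AlgHom.coe_toRingHom, ← PowerSeries.coeff_map, map_list_prod, List.map_map, List.map_cons,
      List.prod_cons, List.map_ofFn, List.prod_ofFn]
    have h0 : PowerSeries.map (MvPolynomial.aeval fun v : Option (Var n) =>
        v.elim (0 : MvPolynomial (Var n) ℚ) MvPolynomial.X).toRingHom (PowerSeries.mk fun b =>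
          (MvPolynomial.X none ^ b : MvPolynomial (Option (Var n)) ℚ)) = 1 := by
      ext1 b
      simp [PowerSeries.coeff_one, zero_pow_eq]
    rw [Function.comp_apply]
    erw [h0]
    rw [one_mul]
    congr 1
    refine Finset.prod_congr rfl fun m _ => ?_
    ext1 b
    simp
  rw [finD, optionEquivLeft_coeff_zero, addVar_eq_eval₂ i hi, Polynomial.eval₂_eq_sum,
    Polynomial.sum, isobaricChain_sum _ hl, map_sum, shiftOmega, Polynomial.sum, map_sum]
  refine Finset.sum_congr rfl fun a _ => ?_
  -- Termwise, the symmetric coefficient leaves the chain, and z = 0 turns it back into the plain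
  -- restriction of f_a.
  rw [RingHom.coe_coe, isobaricChain_mul hl (hinv _), map_mul, map_mul, hΩ, aeval_addVar]

theorem isStableLimit_shiftOmega {r : ℕ} (i : Fin r) (hi : (i : ℕ) + 1 < r) (f : MultiSym r) :
    IsStableLimit (fun n => finD i hi n f) (shiftOmega i hi f) :=
  fun n _ => finRestrict_shiftOmega i hi n f

theorem IsStableLimit.unique {r : ℕ} {F : (n : Fin r → ℕ) → MvPolynomial (Var n) ℚ}
    {g g' : MultiSym r} (h : IsStableLimit F g) (h' : IsStableLimit F g') : g = g' :=
  sub_eq_zero.1 <| eq_zero_of_finRestrict fun n hn => by rw [map_sub, h n hn, h' n hn, sub_self]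

end PlethysticOperators

end

open PlethysticOperators in
theorem mainTheorem4 (r : ℕ) (i : Fin r) (hi : (i : ℕ) + 1 < r) (f : MultiSym r) :
    (∃! g : MultiSym r, IsStableLimit (fun n => finD i hi n f) g) ∧
      D i hi f = (shift i hi f * OmegaZ (next i hi)).coeff 0 := by
  have hlim := isStableLimit_shiftOmega i hi f
  refine ⟨⟨_, hlim, fun g hg => hg.unique hlim⟩, ?_⟩
  have hex : ∃ g, IsStableLimit (fun n => finD i hi n f) g := ⟨_, hlim⟩
  rw [coeff_shift_mul_OmegaZ, D, dif_pos hex]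
  -- `D` is an arbitrarily chosen limit, identified with the explicit one by uniqueness.
  exact hex.choose_spec.unique hlim
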